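/- \textbf{Theorem (exact random generatability implies $\mathsf{BQP}\subseteq\mathsf{P}^{\mathsf{NP}}$).} A family $f=\{f_n\}_{n\in\mathbb N}$, $f_n:\{0,1\}^n\to\{0,1\}$, is called a \emph{$\mathsf{BQP}$ function} if it is the characteristic function of a language $\mathcal L\in\mathsf{BQP}$, i.e. for all $n$ and $x\in\{0,1\}^n$, $f_n(x)=1$ if and only if $x\in\mathcal L$. The family $f$ is called \emph{exactly random generatable under the uniform distribution} if there are descriptions $d_n\in\{0,1\}^*$ of $f_n$, computable from $1^n$ in polynomial time, lengths $\ell(n)$ bounded by a polynomial in $n$ (with $1^{\ell(n)}$ computable from $1^n$ in polynomial time), and a classical polynomial-time algorithm $\mathcal A$ such that for every $n$ and every random string $r\in\{0,1\}^{\ell(n)}$ $$\mathcal A(d_n,r)=(x_r,f_n(x_r))\quad\text{for some } x_r\in\{0,1\}^n,$$ and $x_r$ is uniformly distributed on $\{0,1\}^n$ when $r$ is uniformly distributed on $\{0,1\}^{\ell(n)}$. (1) If $f$ is a $\mathsf{BQP}$ function that is exactly random generatable under the uniform distribution, then the language $\mathcal L\in\mathsf{BQP}$ of which $f$ is the characteristic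 function belongs to $\mathsf{P}^{\mathsf{NP}}$. (2) Consequently, if every $\mathsf{BQP}$ function is exactly random generatable under the uniform distribution, then $\mathsf{BQP}\subseteq\mathsf{P}^{\mathsf{NP}}$. -/

import Mathlib

/-! ## A deterministic machine model with a step count

Machines are programs that act on finitely many stacks of bits (a multi-tape Turing machine is
such a machine with two stacks per tape, and the control is structured instead of being a
transition table; both simulate each other with constant-factor or polynomial overhead).
All elementary operations and tests act on the top of one stack and cost one step.  A machine may
also ask an oracle, at the cost of one step, whether the string on some stack is in the oracle
language. -/

/-- Bit strings. -/
abbrev BitStr : Type := List Bool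

/-- Programs of oracle machines with bit stacks numbered by `ℕ` (each program names only finitely
many of them). -/
inductive StackProg : Type
  /-- push the bit `b` on stack `i` -/
  | push (i : ℕ) (b : Bool) : StackProg
  /-- remove the top of stack `i` (no effect if it is empty) -/
  | pop (i : ℕ) : StackProg
  /-- push on stack `j` the answer of the oracle to the string on stack `i` -/
  | query (i j : ℕ) : StackProg
  /-- run `p` and then `q` -/
  | seq (p q : StackProg) : StackProg
  /-- run `pE`, `pF` or `pT` if stack `i` is empty, has top bit `0`, or has top bit `1` -/
  | cases (i : ℕ) (pE pF pT : StackProg) : StackProg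
  /-- as long as stack `i` is non-empty, run `p` -/
  | loop (i : ℕ) (p : StackProg) : StackProg

/-- The contents of all stacks; the head of a list is the top of the stack. -/
abbrev StackMem : Type := ℕ → BitStr

namespace StackProg

open Classical in
/-- `p.Exec O s t s'`: with oracle `O`, the program `p` started in memory `s` halts after exactly
`t` steps in memory `s'`. -/
inductive Exec (O : Language Bool) : StackProg → StackMem → ℕ → StackMem → Prop
  | push (i : ℕ) (b : Bool) (s : StackMem) :
      Exec O (.push i b) s 1 (Function.update s i (b :: s i))
  | pop (i : ℕ) (s : StackMem) :
      Exec O (.pop i) s 1 (Function.update s i (s i).tail)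
  | query (i j : ℕ) (s : StackMem) :
      Exec O (.query i j) s 1 (Function.update s j (decide (s i ∈ O) :: s j))
  | seq {p q : StackProg} {s s' s'' : StackMem} {t t' : ℕ} :
      Exec O p s t s' → Exec O q s' t' s'' → Exec O (.seq p q) s (t + t') s''
  | cases_empty {i : ℕ} {pE pF pT : StackProg} {s s' : StackMem} {t : ℕ} :
      s i = [] → Exec O pE s t s' → Exec O (.cases i pE pF pT) s (1 + t) s'
  | cases_false {i : ℕ} {pE pF pT : StackProg} {s s' : StackMem} {t : ℕ} :
      (s i).head? = some false → Exec O pF s t s' → Exec O (.cases i pE pF pT) s (1 + t) s'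
  | cases_true {i : ℕ} {pE pF pT : StackProg} {s s' : StackMem} {t : ℕ} :
      (s i).head? = some true → Exec O pT s t s' → Exec O (.cases i pE pF pT) s (1 + t) s'
  | loop_done {i : ℕ} {p : StackProg} {s : StackMem} :
      s i = [] → Exec O (.loop i p) s 1 s
  | loop_step {i : ℕ} {p : StackProg} {s s' s'' : StackMem} {t t' : ℕ} :
      s i ≠ [] → Exec O p s t s' → Exec O (.loop i p) s' t' s'' →
      Exec O (.loop i p) s (1 + t + t') s''

/-- The initial memory: the inputs are on stacks `0, 1, …`, all other stacks are empty. -/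
def load (inputs : List BitStr) : StackMem := fun i => inputs.getD i []

/-- With oracle `O`, on the given inputs, `p` halts after at most `T` steps with the string `out`
on stack `0`. -/
def OutputsWithin (p : StackProg) (O : Language Bool) (inputs : List BitStr) (T : ℕ)
    (out : BitStr) : Prop :=
  ∃ t ≤ T, ∃ s : StackMem, p.Exec O (load inputs) t s ∧ s 0 = out

end StackProg

/-! ## Polynomial time, `NP`, and `P` with an `NP` oracle

A machine without oracle is a machine with the empty oracle (every query is answered "no"). -/

/-- `f` is computable in (deterministic, classical) polynomial time. -/
def PolyTime₁ (f : BitStr → BitStr) : Prop :=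
  ∃ (p : StackProg) (T : Polynomial ℕ), ∀ x : BitStr,
    p.OutputsWithin 0 [x] (T.eval x.length) (f x)

/-- The function `f` of two strings is computable in polynomial time. -/
def PolyTime₂ (f : BitStr → BitStr → BitStr) : Prop :=
  ∃ (p : StackProg) (T : Polynomial ℕ), ∀ x y : BitStr,
    p.OutputsWithin 0 [x, y] (T.eval (x.length + y.length)) (f x y)

/-- The sequence of strings `g 0, g 1, …` is polynomial-time uniform: `g n` is computed from the
unary string `1ⁿ` in polynomial time. -/
def PolyTimeUniform (g : ℕ → BitStr) : Prop :=
  ∃ f : BitStr → BitStr, PolyTime₁ f ∧ ∀ n : ℕ, f (List.replicate n true) = g n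

/-- The class `P^O`: languages decided in polynomial time with oracle `O`. -/
def ClassPWithOracle (O : Language Bool) : Set (Language Bool) :=
  {L | ∃ (p : StackProg) (T : Polynomial ℕ), ∀ x : BitStr, ∃ b : Bool,
    p.OutputsWithin O [x] (T.eval x.length) [b] ∧ (b = true ↔ x ∈ L)}

/-- The class `NP`: languages with polynomially long witnesses that are verified in polynomial
time. -/
def ClassNP : Set (Language Bool) :=
  {L | ∃ (V : BitStr → BitStr → BitStr) (q : Polynomial ℕ), PolyTime₂ V ∧
    ∀ x : BitStr, x ∈ L ↔ ∃ w : BitStr, w.length ≤ q.eval x.length ∧ V x w = [true]}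

/-- The class `P^NP`. -/
def ClassPNP : Set (Language Bool) :=
  {L | ∃ O ∈ ClassNP, L ∈ ClassPWithOracle O}

/-! ## Quantum circuits and `BQP` -/

/-- Elementary gates on `m` qubits: Hadamard, `T = diag(1, exp(iπ/4))`, and `CNOT`
(with control `c` and target `t`). -/
inductive QGate (m : ℕ) : Type
  | hadamard (i : Fin m) : QGate m
  | tgate (i : Fin m) : QGate m
  | cnot (c t : Fin m) (hne : c ≠ t) : QGate m

/-- A vector of `m`-qubit amplitudes, indexed by the computational basis. -/
abbrev QState (m : ℕ) : Type := (Fin m → Bool) → ℂ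

namespace QGate

/-- The unitary action of a gate on amplitudes. -/
noncomputable def apply {m : ℕ} : QGate m → QState m → QState m
  | .hadamard i, ψ => fun z =>
      (1 / (Real.sqrt 2 : ℂ)) * (ψ (Function.update z i false) +
        (if z i then -1 else 1) * ψ (Function.update z i true))
  | .tgate i, ψ => fun z =>
      (if z i then Complex.exp (Complex.I * (Real.pi / 4 : ℝ)) else 1) * ψ z
  | .cnot c t _, ψ => fun z => ψ (Function.update z t (xor (z t) (z c)))

/-- A prefix-free binary code of gates, with qubit numbers in unary. -/
def code {m : ℕ} : QGate m → BitStr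
  | .hadamard i => [false, false] ++ List.replicate i.val true ++ [false]
  | .tgate i => [false, true] ++ List.replicate i.val true ++ [false]
  | .cnot c t _ =>
      [true] ++ List.replicate c.val true ++ [false] ++ List.replicate t.val true ++ [false]

end QGate

/-- A quantum circuit for inputs of `n` bits: it acts on `n` input qubits and `ancillas + 1`
further qubits, which start in state `0`. -/
structure QCircuit (n : ℕ) : Type where
  ancillas : ℕ
  gates : List (QGate (n + ancillas + 1))

namespace QCircuit

/-- The binary description of a circuit. -/
def code {n : ℕ} (C : QCircuit n) : BitStr :=
  List.replicate C.ancillas true ++ [false] ++ C.gates.flatMap QGate.code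

/-- The basis state in which the circuit starts: the input `x` followed by zeros. -/
def inputBits {n : ℕ} (C : QCircuit n) (x : Fin n → Bool) : Fin (n + C.ancillas + 1) → Bool :=
  fun i => if h : i.val < n then x ⟨i.val, h⟩ else false

/-- The final state of the circuit on input `x`; the gates are applied from left to right. -/
noncomputable def finalState {n : ℕ} (C : QCircuit n) (x : Fin n → Bool) :
    QState (n + C.ancillas + 1) :=
  C.gates.foldl (fun ψ g => g.apply ψ) (fun z => if z = C.inputBits x then 1 else 0)

/-- The probability that measuring the first qubit at the end gives `1`. -/
noncomputable def acceptProb {n : ℕ} (C : QCircuit n) (x : Fin n → Bool) : ℝ :=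
  ∑ z : Fin (n + C.ancillas + 1) → Bool, if z 0 = true then ‖C.finalState x z‖ ^ 2 else 0

end QCircuit

/-- The class `BQP`: languages decided with error probability at most `1/3` by a polynomial-time
uniform family of quantum circuits. -/
def ClassBQP : Set (Language Bool) :=
  {L | ∃ C : (n : ℕ) → QCircuit n, PolyTimeUniform (fun n => (C n).code) ∧
    ∀ (n : ℕ) (x : Fin n → Bool),
      (List.ofFn x ∈ L → 2 / 3 ≤ (C n).acceptProb x) ∧
      (List.ofFn x ∉ L → (C n).acceptProb x ≤ 1 / 3)}

/-! ## Families of Boolean functions and exact random generatability -/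

/-- A family of functions `f_n : {0,1}ⁿ → {0,1}`. -/
abbrev BoolFamily : Type := (n : ℕ) → (Fin n → Bool) → Bool

/-- The language of which `f` is the characteristic function. -/
def BoolFamily.language (f : BoolFamily) : Language Bool :=
  {w : BitStr | f w.length w.get = true}

/-- `f` is the characteristic function of a language in `BQP`. -/
def IsBQPFunction (f : BoolFamily) : Prop :=
  ∃ L ∈ ClassBQP, ∀ (n : ℕ) (x : Fin n → Bool), f n x = true ↔ List.ofFn x ∈ L

/-- `f` is exactly random generatable under the input distributions `D n`: there is a
polynomial-time algorithm `A` which, given a description `desc n` of `f_n` and a random string `r`,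
always outputs a pair `(x_r, f_n(x_r))`, written as the `n` bits of `x_r` followed by the bit
`f_n(x_r)`, and `x_r` has law `D n` for uniformly random `r` of length `ℓ n`.
The family is uniform: the descriptions (in whatever format) are computed from `1ⁿ` in polynomial
time, and so are the lengths `ℓ n` in unary, which are therefore polynomially bounded. -/
def ExactRandomGeneratable (f : BoolFamily) (D : (n : ℕ) → PMF (Fin n → Bool)) : Prop :=
  ∃ (desc : ℕ → BitStr) (ℓ : ℕ → ℕ) (A : BitStr → BitStr → BitStr),
    PolyTimeUniform desc ∧
    PolyTimeUniform (fun n => List.replicate (ℓ n) true) ∧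
    PolyTime₂ A ∧
    ∀ n : ℕ, ∃ X : (Fin (ℓ n) → Bool) → (Fin n → Bool),
      (∀ r : Fin (ℓ n) → Bool,
        A (desc n) (List.ofFn r) = List.ofFn (X r) ++ [f n (X r)]) ∧
      (PMF.uniformOfFintype (Fin (ℓ n) → Bool)).map X = D n

/-- The uniform distributions on `{0,1}ⁿ`. -/
noncomputable def uniformInputs (n : ℕ) : PMF (Fin n → Bool) :=
  PMF.uniformOfFintype (Fin n → Bool)

/-! The language is already in `NP`: a witness for `x` is a random string `r` from which the
generator `A` outputs `(x, 1)`. Since the law of the generated input is uniform, every `x` lies in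
its support and is generated by some `r`; since generation is exact, the bit that comes with `x` is
always `f x`. So a witness exists precisely when `f x = 1`. Its length is `ℓ n`, which is
polynomially bounded because `1^ℓ(n)` is written in polynomial time.
`ExactRandomGeneratable.language_mem_ClassNP` carries this argument, and `ClassNP_subset_ClassPNP`
finishes part (1). Part (2) applies it to the characteristic family of each language. Most of the
work is an explicit verifier, `generationVerifier`, built from the given machines as subroutines on
disjoint stacks. `Exec.rename` makes such calls possible, and `Exec.length_le` bounds the
intermediate strings by running times. -/

namespace StackProg

/-! ### Renumbered stacks and growth of stacks -/

/-- Renumber the stacks of a program. -/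
def rename (σ : ℕ → ℕ) : StackProg → StackProg
  | push i b => push (σ i) b
  | pop i => pop (σ i)
  | query i j => query (σ i) (σ j)
  | seq p q => seq (p.rename σ) (q.rename σ)
  | cases i pE pF pT => cases (σ i) (pE.rename σ) (pF.rename σ) (pT.rename σ)
  | loop i p => loop (σ i) (p.rename σ)

/-- A program with injectively renumbered stacks acts on the renumbered stacks as the original
program does, and leaves all other stacks unchanged. -/
theorem Exec.rename {O : Language Bool} {σ : ℕ → ℕ} (hσ : Function.Injective σ)
    {p : StackProg} {s s' : StackMem} {t : ℕ} (h : Exec O p s t s') :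
    ∀ m : StackMem, m ∘ σ = s →
      ∃ m', Exec O (p.rename σ) m t m' ∧ m' ∘ σ = s' ∧ ∀ j ∉ Set.range σ, m' j = m j := by
  have upd : ∀ (m : StackMem) (i : ℕ) (v : BitStr),
      Function.update m (σ i) v ∘ σ = Function.update (m ∘ σ) i v ∧
        ∀ j ∉ Set.range σ, Function.update m (σ i) v j = m j := by
    refine fun m i v => ⟨Function.update_comp_eq_of_injective m hσ i v, fun j hj => ?_⟩
    exact Function.update_of_ne (fun e => hj ⟨i, e.symm⟩) _ _
  induction h with
  | push i b s =>
    rintro m rfl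
    exact ⟨_, .push (σ i) b m, upd m i _⟩
  | pop i s =>
    rintro m rfl
    exact ⟨_, .pop (σ i) m, upd m i _⟩
  | query i j s =>
    rintro m rfl
    exact ⟨_, .query (σ i) (σ j) m, upd m j _⟩
  | seq _ _ ih₁ ih₂ =>
    intro m hm
    obtain ⟨m₁, h₁, e₁, f₁⟩ := ih₁ m hm
    obtain ⟨m₂, h₂, e₂, f₂⟩ := ih₂ m₁ e₁
    exact ⟨m₂, .seq h₁ h₂, e₂, fun j hj => (f₂ j hj).trans (f₁ j hj)⟩
  | cases_empty hi _ ih =>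
    rintro m rfl
    obtain ⟨m₁, h₁, e₁, f₁⟩ := ih m rfl
    exact ⟨m₁, .cases_empty hi h₁, e₁, f₁⟩
  | cases_false hi _ ih =>
    rintro m rfl
    obtain ⟨m₁, h₁, e₁, f₁⟩ := ih m rfl
    exact ⟨m₁, .cases_false hi h₁, e₁, f₁⟩
  | cases_true hi _ ih =>
    rintro m rfl
    obtain ⟨m₁, h₁, e₁, f₁⟩ := ih m rfl
    exact ⟨m₁, .cases_true hi h₁, e₁, f₁⟩
  | loop_done hi =>
    rintro m rfl
    exact ⟨m, .loop_done hi, rfl, fun _ _ => rfl⟩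
  | loop_step hi _ _ ih₁ ih₂ =>
    rintro m rfl
    obtain ⟨m₁, h₁, e₁, f₁⟩ := ih₁ m rfl
    obtain ⟨m₂, h₂, e₂, f₂⟩ := ih₂ m₁ e₁
    exact ⟨m₂, .loop_step hi h₁ h₂, e₂, fun j hj => (f₂ j hj).trans (f₁ j hj)⟩

/-- A stack grows by at most one bit per step. -/
theorem Exec.length_le {O : Language Bool} {p : StackProg} {s s' : StackMem} {t : ℕ}
    (h : Exec O p s t s') (j : ℕ) : (s' j).length ≤ (s j).length + t := by
  have upd : ∀ (s : StackMem) (i : ℕ) (v : BitStr), v.length ≤ (s i).length + 1 →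
      (Function.update s i v j).length ≤ (s j).length + 1 := by
    intro s i v hv
    rcases eq_or_ne j i with rfl | hj
    · simpa using hv
    · simp [Function.update_of_ne hj]
  induction h with
  | push i b s => exact upd s i _ (by simp)
  | pop i s => exact upd s i _ (by simp; omega)
  | query i k s => exact upd s k _ (by simp)
  | loop_done => omega
  | _ => omega

theorem OutputsWithin.length_le {O : Language Bool} {p : StackProg} {x : BitStr} {T : ℕ}
    {out : BitStr} (h : p.OutputsWithin O [x] T out) : out.length ≤ x.length + T := by
  obtain ⟨t, ht, s, hs, rfl⟩ := h
  have := hs.length_le 0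
  simp only [load, List.getD_cons_zero] at this
  omega

/-! ### Executions with an upper bound on the time -/

/-- With oracle `O`, the program `p` started in memory `s` halts after at most `T` steps in
memory `s'`. -/
def Reaches (O : Language Bool) (p : StackProg) (s : StackMem) (T : ℕ) (s' : StackMem) : Prop :=
  ∃ t ≤ T, p.Exec O s t s'

section Reaches

variable {O : Language Bool} {p q r : StackProg} {s s' s'' : StackMem} {T T' : ℕ}

theorem Exec.reaches {t : ℕ} (h : p.Exec O s t s') : Reaches O p s t s' := ⟨t, le_rfl, h⟩

theorem Reaches.mono (h : Reaches O p s T s') (hT : T ≤ T') : Reaches O p s T' s' := by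
  obtain ⟨t, ht, h⟩ := h
  exact ⟨t, ht.trans hT, h⟩

theorem Reaches.seq (h : Reaches O p s T s') (h' : Reaches O q s' T' s'') :
    Reaches O (.seq p q) s (T + T') s'' := by
  obtain ⟨t, ht, h⟩ := h
  obtain ⟨t', ht', h'⟩ := h'
  exact ⟨t + t', by omega, .seq h h'⟩

theorem Reaches.cases_empty {i : ℕ} (hi : s i = []) (h : Reaches O p s T s') :
    Reaches O (.cases i p q r) s (1 + T) s' := by
  obtain ⟨t, ht, h⟩ := h
  exact ⟨1 + t, by omega, .cases_empty hi h⟩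

theorem Reaches.cases_false {i : ℕ} (hi : (s i).head? = some false) (h : Reaches O q s T s') :
    Reaches O (.cases i p q r) s (1 + T) s' := by
  obtain ⟨t, ht, h⟩ := h
  exact ⟨1 + t, by omega, .cases_false hi h⟩

theorem Reaches.cases_true {i : ℕ} (hi : (s i).head? = some true) (h : Reaches O r s T s') :
    Reaches O (.cases i p q r) s (1 + T) s' := by
  obtain ⟨t, ht, h⟩ := h
  exact ⟨1 + t, by omega, .cases_true hi h⟩

theorem Reaches.loop_step {i : ℕ} (hi : s i ≠ []) (h : Reaches O p s T s')
    (h' : Reaches O (.loop i p) s' T' s'') : Reaches O (.loop i p) s (1 + T + T') s'' := by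
  obtain ⟨t, ht, h⟩ := h
  obtain ⟨t', ht', h'⟩ := h'
  exact ⟨1 + t + t', by omega, .loop_step hi h h'⟩

end Reaches

/-- A program run as a subroutine on renumbered stacks. -/
theorem OutputsWithin.rename {O : Language Bool} {σ : ℕ → ℕ} (hσ : Function.Injective σ)
    {p : StackProg} {inputs : List BitStr} {T : ℕ} {out : BitStr}
    (h : p.OutputsWithin O inputs T out) {m : StackMem} (hm : ∀ i, m (σ i) = load inputs i) :
    ∃ m', Reaches O (p.rename σ) m T m' ∧ m' (σ 0) = out ∧
      ∀ j, (∀ i, σ i ≠ j) → m' j = m j := by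
  obtain ⟨t, ht, s, hs, rfl⟩ := h
  obtain ⟨m', h', e, f⟩ := hs.rename hσ m (funext hm)
  exact ⟨m', ⟨t, ht, h'⟩, congrFun e 0, fun j hj => f j (by simpa using hj)⟩

/-! ### Moving and comparing strings -/

/-- Move the bits of stack `i` to stack `a`, which reverses them, and push their number in unary
on stack `b`. -/
def transfer (i a b : ℕ) : StackProg :=
  .loop i (.seq (.cases i (.push a true) (.push a false) (.push a true))
    (.seq (.pop i) (.push b true)))

/-- The memory after a transfer. -/
def transferMem (i a b : ℕ) (s : StackMem) : StackMem :=
  Function.update (Function.update (Function.update s i []) a ((s i).reverse ++ s a)) b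
    (List.replicate (s i).length true ++ s b)

/-- Induction on the contents of stack `i`. Each bit costs five steps: the loop test, two for the
case distinction and push, the pop, and the unary count. -/
theorem transfer_reaches (O : Language Bool) {i a b : ℕ} (hia : i ≠ a) (hib : i ≠ b) (hab : a ≠ b)
    (s : StackMem) :
    Reaches O (transfer i a b) s (5 * (s i).length + 1) (transferMem i a b s) := by
  unfold transferMem
  generalize hl : s i = l
  induction l generalizing s with
  | nil =>
    have e : Function.update (Function.update (Function.update s i []) a ([].reverse ++ s a)) b
        (List.replicate (List.length ([] : BitStr)) true ++ s b) = s := by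
      funext j
      simp only [Function.update_apply]
      grind
    rw [e]
    exact Exec.reaches (.loop_done hl)
  | cons c l ih =>
    have h₁ : Reaches O (.cases i (.push a true) (.push a false) (.push a true)) s (1 + 1)
        (Function.update s a (c :: s a)) := by
      cases c
      · exact .cases_false (by simp [hl]) (Exec.reaches (.push a false s))
      · exact .cases_true (by simp [hl]) (Exec.reaches (.push a true s))
    have h₂ := h₁.seq ((Exec.reaches (O := O) (.pop i _)).seq (Exec.reaches (.push b true _)))
    have h₃ := Reaches.loop_step (by simp [hl]) h₂
      (ih _ (by simp [hia, hib, hl]))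
    have e : ∀ {m m' : StackMem} {T T' : ℕ}, Reaches O (transfer i a b) s T m → T ≤ T' → m = m' →
        Reaches O (transfer i a b) s T' m' := by
      rintro m _ T T' h hT rfl
      exact h.mono hT
    refine e h₃ (by simp only [List.length_cons]; omega) ?_
    -- The mark pushed in this round ends up below the later ones; in a unary string this makes no
    -- difference.
    have hrep : ∀ k, List.replicate l.length true ++ true :: k =
        List.replicate (c :: l).length true ++ k := by
      simp [List.replicate_succ']
    funext j
    simp only [Function.update_apply]
    grind

/-- Compare stacks `a` and `b`: afterwards stack `c` is empty if and only if it was empty before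
and the two stacks were equal. -/
def compare (a b c : ℕ) : StackProg :=
  .seq
    (.loop a (.seq
      (.cases b (.push c true)
        (.cases a (.push c true) (.pop b) (.push c true))
        (.cases a (.push c true) (.push c true) (.pop b)))
      (.pop a)))
    (.loop b (.seq (.pop b) (.push c true)))

/-- Stack `c` is a flag that is never popped, so a recorded mismatch persists and consecutive
comparisons can share it. The first loop consumes `a` against `b`; the second flags whatever remains
on `b`. -/
theorem compare_reaches (O : Language Bool) {a b c : ℕ} (hab : a ≠ b) (hac : a ≠ c) (hbc : b ≠ c)
    (s : StackMem) :
    ∃ s', Reaches O (compare a b c) s (5 * (s a).length + 3 * (s b).length + 2) s' ∧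
      (s' c = [] ↔ s c = [] ∧ s a = s b) ∧
      ∀ j, j ≠ a → j ≠ b → j ≠ c → s' j = s j := by
  -- The invariant combines the flag with the rest of `b`. The bound on the length of `b` is for the
  -- running time of the second loop.
  have first : ∀ (l : BitStr) (s : StackMem), s a = l → ∃ s',
      Reaches O (.loop a (.seq
        (.cases b (.push c true)
          (.cases a (.push c true) (.pop b) (.push c true))
          (.cases a (.push c true) (.push c true) (.pop b)))
        (.pop a))) s (5 * l.length + 1) s' ∧
      ((s' c = [] ∧ s' b = []) ↔ s c = [] ∧ l = s b) ∧ (s' b).length ≤ (s b).length ∧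
      ∀ j, j ≠ a → j ≠ b → j ≠ c → s' j = s j := by
    intro l
    induction l with
    | nil =>
      intro s hl
      exact ⟨s, Exec.reaches (.loop_done hl), by grind, le_rfl, fun _ _ _ _ => rfl⟩
    | cons d l ih =>
      intro s hl
      have step : ∃ m, Reaches O (.cases b (.push c true)
          (.cases a (.push c true) (.pop b) (.push c true))
          (.cases a (.push c true) (.push c true) (.pop b))) s (1 + (1 + 1)) m ∧
          m a = s a ∧ ((m c = [] ∧ l = m b) ↔ s c = [] ∧ d :: l = s b) ∧
          (m b).length ≤ (s b).length ∧ ∀ j, j ≠ a → j ≠ b → j ≠ c → m j = s j := by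
        rcases hb : s b with _ | ⟨e, k⟩
        · refine ⟨_, (Reaches.cases_empty hb (Exec.reaches (.push c true s))).mono (by omega),
            ?_, ?_, ?_, ?_⟩ <;> simp [Function.update_apply] <;> grind
        · have hit : ∀ m : StackMem, m = Function.update s b (s b).tail → d = e → m a = s a ∧
              ((m c = [] ∧ l = m b) ↔ s c = [] ∧ d :: l = e :: k) ∧
              (m b).length ≤ (e :: k).length ∧ ∀ j, j ≠ a → j ≠ b → j ≠ c → m j = s j := by
            rintro m rfl rfl
            simp only [Function.update_apply]
            grind
          -- Here `b` is not popped, so the stacks lose alignment; with the flag set, both sides of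
          -- the equivalence are false anyway.
          have miss : ∀ m : StackMem, m = Function.update s c (true :: s c) → d ≠ e → m a = s a ∧
              ((m c = [] ∧ l = m b) ↔ s c = [] ∧ d :: l = e :: k) ∧
              (m b).length ≤ (e :: k).length ∧ ∀ j, j ≠ a → j ≠ b → j ≠ c → m j = s j := by
            rintro m rfl hde
            simp only [Function.update_apply]
            grind
          cases e <;> cases d
          · exact ⟨_, .cases_false (by simp [hb]) (.cases_false (by simp [hl])
              (Exec.reaches (.pop b s))), hit _ rfl rfl⟩
          · exact ⟨_, .cases_false (by simp [hb]) (.cases_true (by simp [hl])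
              (Exec.reaches (.push c true s))), miss _ rfl (by simp)⟩
          · exact ⟨_, .cases_true (by simp [hb]) (.cases_false (by simp [hl])
              (Exec.reaches (.push c true s))), miss _ rfl (by simp)⟩
          · exact ⟨_, .cases_true (by simp [hb]) (.cases_true (by simp [hl])
              (Exec.reaches (.pop b s))), hit _ rfl rfl⟩
      obtain ⟨m, hm, ma, mc, mb, mj⟩ := step
      obtain ⟨s', h', e', f', g'⟩ := ih (Function.update m a (m a).tail) (by simp [ma, hl])
      simp only [Function.update_of_ne hac.symm, Function.update_of_ne hab.symm] at e' f'
      refine ⟨s', ((Reaches.loop_step (by simp [hl]) (hm.seq (Exec.reaches (.pop a m))) h').mono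
        (by simp only [List.length_cons]; omega)), e'.trans mc, f'.trans mb, fun j ja jb jc => ?_⟩
      rw [g' j ja jb jc, Function.update_of_ne ja, mj j ja jb jc]
  have second : ∀ (l : BitStr) (s : StackMem), s b = l → ∃ s',
      Reaches O (.loop b (.seq (.pop b) (.push c true))) s (3 * l.length + 1) s' ∧
      (s' c = [] ↔ s c = [] ∧ l = []) ∧ ∀ j, j ≠ b → j ≠ c → s' j = s j := by
    intro l
    induction l with
    | nil =>
      intro s hl
      exact ⟨s, Exec.reaches (.loop_done hl), by simp, fun _ _ _ => rfl⟩
    | cons d l ih =>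
      intro s hl
      have h := (Exec.reaches (O := O) (.pop b s)).seq (Exec.reaches (.push c true _))
      obtain ⟨s', h', e', f'⟩ := ih (Function.update (Function.update s b (s b).tail) c
          (true :: Function.update s b (s b).tail c)) (by simp [hl, hbc])
      refine ⟨s', (Reaches.loop_step (by simp [hl]) h h').mono
        (by simp only [List.length_cons]; omega), ?_, fun j jb jc => ?_⟩
      · simpa using e'
      · rw [f' j jb jc, Function.update_of_ne jc, Function.update_of_ne jb]
  obtain ⟨m, hm, mc, mb, mj⟩ := first _ s rfl
  obtain ⟨s', h', e', f'⟩ := second _ m rfl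
  exact ⟨s', (hm.seq h').mono (by omega), e'.trans mc,
    fun j ja jb jc => (f' j jb jc).trans (mj j ja jb jc)⟩

/-! ### The verifier -/

/-- Three disjoint families of work stacks, which leave the stacks below `8` free. -/
def workStack (k : Fin 3) (i : ℕ) : ℕ := 8 + k + 3 * i

theorem workStack_injective (k : Fin 3) : Function.Injective (workStack k) := by
  intro i j h
  simp only [workStack] at h
  omega

/-- For inputs `x` and `w`: check that `w` has the length that `pLen` computes from the unary
length of `x`, and that `pA`, on `w` and the description that `pDesc` computes from the unary
length of `x`, outputs `x` followed by the bit `1`. -/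
def generationVerifier (pDesc pLen pA : StackProg) : StackProg :=
  .seq (transfer 0 3 9) <| .seq (transfer 3 4 10) <| .seq (transfer 4 2 6) <|
  .seq (pDesc.rename (workStack 1)) <| .seq (pLen.rename (workStack 2)) <|
  .seq (transfer 9 3 6) <| .seq (transfer 3 8 6) <|
  .seq (transfer 1 3 6) <| .seq (transfer 3 11 4) <|
  .seq (pA.rename (workStack 0)) <|
  .seq (transfer 8 3 6) <| .seq (.push 2 true) <|
  .seq (compare 4 10 5) <| .seq (compare 3 2 5) <|
  .cases 5 (.push 0 true) (.pop 0) (.pop 0)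

/-- Stacks `8`, `9`, `10` are stack `0` of `pA`, `pDesc`, `pLen`, and `11` is stack `1` of `pA`;
transfers place the inputs there. Reversals are undone by a second transfer where order matters, and
counts sent to stack `6` are discarded. The transfer phases are stated for an arbitrary
continuation, to fit the right-nested sequence. -/
theorem generationVerifier_outputsWithin {O : Language Bool} {pDesc pLen pA : StackProg}
    {x w d u out : BitStr} {T₁ T₂ T₃ : ℕ}
    (h₁ : pDesc.OutputsWithin O [List.replicate x.length true] T₁ d)
    (h₂ : pLen.OutputsWithin O [List.replicate x.length true] T₂ u)
    (h₃ : pA.OutputsWithin O [d, w] T₃ out) :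
    (generationVerifier pDesc pLen pA).OutputsWithin O [x, w]
      (T₁ + T₂ + T₃ + 18 * x.length + 15 * w.length + 10 * d.length + 10 * out.length
        + 3 * u.length + 20)
      (if List.replicate w.length true = u ∧ out = x ++ [true] then [true] else []) := by
  have init : ∀ i, load [x, w] i = if i = 0 then x else if i = 1 then w else [] := by
    rintro (_ | _ | i) <;> simp [load]
  generalize hs : load [x, w] = s at init
  have init₁ : ∀ (y : BitStr) i, load [y] i = if i = 0 then y else [] := by
    rintro y (_ | i) <;> simp [load]
  have init₂ : ∀ (y z : BitStr) i, load [y, z] i = if i = 0 then y else if i = 1 then z else [] := by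
    rintro y z (_ | _ | i) <;> simp [load]
  -- reading and copying `x`
  obtain ⟨m, hm, m1, m2, m9, m10, mo⟩ : ∃ m, (∀ p T s', Reaches O p m T s' →
      Reaches O (.seq (transfer 0 3 9) <| .seq (transfer 3 4 10) <| .seq (transfer 4 2 6) p) s
        (15 * x.length + 3 + T) s') ∧ m 1 = w ∧ m 2 = x.reverse ∧
      m 9 = List.replicate x.length true ∧ m 10 = List.replicate x.length true ∧
      ∀ j, j ≠ 1 → j ≠ 2 → j ≠ 9 → j ≠ 10 → j ≠ 6 → m j = [] := by
    have t₁ := transfer_reaches O (i := 0) (a := 3) (b := 9) (by simp) (by simp) (by simp) s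
    generalize e₁ : transferMem 0 3 9 s = s₁ at t₁
    have t₂ := transfer_reaches O (i := 3) (a := 4) (b := 10) (by simp) (by simp) (by simp) s₁
    generalize e₂ : transferMem 3 4 10 s₁ = s₂ at t₂
    have t₃ := transfer_reaches O (i := 4) (a := 2) (b := 6) (by simp) (by simp) (by simp) s₂
    generalize e₃ : transferMem 4 2 6 s₂ = s₃ at t₃
    have l₁ : s 0 = x := by simp [init]
    have l₂ : s₁ 3 = x.reverse := by simp [← e₁, init, transferMem]
    have l₃ : s₂ 4 = x := by simp [← e₂, ← e₁, init, transferMem]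
    refine ⟨s₃, fun p T s' h => (t₁.seq (t₂.seq (t₃.seq h))).mono ?_, ?_, ?_, ?_, ?_, ?_⟩
    · rw [l₁, l₂, l₃, List.length_reverse]
      omega
    · simp [← e₃, ← e₂, ← e₁, init, transferMem]
    · simp [← e₃, l₃, transferMem]
      simp [← e₂, ← e₁, init, transferMem]
    · simp [← e₃, ← e₂, ← e₁, init, transferMem]
    · simp [← e₃, ← e₂, ← e₁, init, transferMem]
    · intro j j1 j2 j9 j10 j6
      simp only [← e₃, ← e₂, ← e₁, init, Function.update_apply, transferMem]
      grind
  -- the description and the length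
  obtain ⟨a, ha, a0, af⟩ := h₁.rename (workStack_injective 1) (m := m) (fun i => by
    rw [init₁]
    rcases i with _ | i
    · simpa [workStack] using m9
    · rw [if_neg (by omega)]
      apply mo <;> simp only [workStack, Fin.val_one] <;> omega)
  obtain ⟨b, hb, b0, bf⟩ := h₂.rename (workStack_injective 2) (m := a) (fun i => by
    rw [init₁, af _ (by intro k; simp only [workStack, Fin.val_one, Fin.val_two]; omega)]
    rcases i with _ | i
    · simpa [workStack] using m10
    · rw [if_neg (by omega)]
      apply mo <;> simp only [workStack, Fin.val_two] <;> omega)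
  -- The two subroutines touch only stacks from `9` on, with residues `0` and `1` modulo `3`.
  have ba : ∀ j, j < 9 ∨ j % 3 = 2 → b j = m j := by
    intro j hj
    rw [bf j (by intro k; simp only [workStack, Fin.val_two]; omega),
      af j (by intro k; simp only [workStack, Fin.val_one]; omega)]
  replace a0 : b 9 = d := by
    rw [bf 9 (by intro k; simp only [workStack, Fin.val_two]; omega), ← a0]
    simp [workStack]
  replace b0 : b 10 = u := by
    simpa [workStack] using b0
  -- loading the inputs of `pA`
  obtain ⟨c, hc, c2, c4, c10, cj, cw⟩ : ∃ c, (∀ p T s', Reaches O p c T s' →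
      Reaches O (.seq (transfer 9 3 6) <| .seq (transfer 3 8 6) <|
        .seq (transfer 1 3 6) <| .seq (transfer 3 11 4) p) b
        (10 * d.length + 10 * w.length + 4 + T) s') ∧ c 2 = x.reverse ∧
      c 4 = List.replicate w.length true ∧ c 10 = u ∧ (∀ j, j = 0 ∨ j = 3 ∨ j = 5 → c j = []) ∧
      ∀ i, c (workStack 0 i) = load [d, w] i := by
    have t₁ := transfer_reaches O (i := 9) (a := 3) (b := 6) (by simp) (by simp) (by simp) b
    generalize e₁ : transferMem 9 3 6 b = s₁ at t₁
    have t₂ := transfer_reaches O (i := 3) (a := 8) (b := 6) (by simp) (by simp) (by simp) s₁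
    generalize e₂ : transferMem 3 8 6 s₁ = s₂ at t₂
    have t₃ := transfer_reaches O (i := 1) (a := 3) (b := 6) (by simp) (by simp) (by simp) s₂
    generalize e₃ : transferMem 1 3 6 s₂ = s₃ at t₃
    have t₄ := transfer_reaches O (i := 3) (a := 11) (b := 4) (by simp) (by simp) (by simp) s₃
    generalize e₄ : transferMem 3 11 4 s₃ = s₄ at t₄
    have b1 : b 1 = w := (ba 1 (by omega)).trans m1
    have b2 : b 2 = x.reverse := (ba 2 (by omega)).trans m2
    have bn : ∀ j, j = 0 ∨ j = 3 ∨ j = 4 ∨ j = 5 ∨ j = 8 ∨ 11 ≤ j ∧ j % 3 = 2 → b j = [] := by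
      intro j hj
      rw [ba j (by omega)]
      apply mo <;> omega
    have l₂ : s₁ 3 = d.reverse := by simp [← e₁, a0, bn, transferMem]
    have k₂ : ∀ j, j ≠ 9 → j ≠ 3 → j ≠ 6 → s₁ j = b j := by
      intro j j1 j2 j3
      simp only [← e₁, Function.update_apply, if_neg j1, if_neg j2, if_neg j3, transferMem]
    have n₂ : s₂ 3 = [] := by simp [← e₂, transferMem]
    have n₂' : s₂ 8 = d := by simp [← e₂, l₂, k₂, bn, transferMem]
    have k₃ : ∀ j, j ≠ 9 → j ≠ 3 → j ≠ 6 → j ≠ 8 → s₂ j = b j := by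
      intro j j1 j2 j3 j4
      simp only [← e₂, Function.update_apply, if_neg j4, if_neg j2, if_neg j3, k₂ j j1 j2 j3, transferMem]
    have l₃ : s₂ 1 = w := by simp [k₃, b1]
    have l₄ : s₃ 3 = w.reverse := by simp [← e₃, l₃, n₂, transferMem]
    have k₄ : ∀ j, j ≠ 1 → j ≠ 3 → j ≠ 6 → s₃ j = s₂ j := by
      intro j j1 j2 j3
      simp only [← e₃, Function.update_apply, if_neg j1, if_neg j2, if_neg j3, transferMem]
    have k₅ : ∀ j, j ≠ 3 → j ≠ 11 → j ≠ 4 → s₄ j = s₃ j := by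
      intro j j1 j2 j3
      simp only [← e₄, Function.update_apply, if_neg j1, if_neg j2, if_neg j3, transferMem]
    refine ⟨s₄, fun p T s' h => (t₁.seq (t₂.seq (t₃.seq (t₄.seq h)))).mono ?_, ?_, ?_, ?_, ?_, ?_⟩
    · rw [a0, l₂, l₃, l₄, List.length_reverse, List.length_reverse]
      omega
    · simp [k₅, k₄, k₃, b2]
    · simp [← e₄, l₄, k₄, k₃, bn, transferMem]
    · simp [k₅, k₄, k₃, b0]
    · rintro j (rfl | rfl | rfl)
      · simp [k₅, k₄, k₃, bn]
      · simp [← e₄, transferMem]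
      · simp [k₅, k₄, k₃, bn]
    · intro i
      rw [init₂]
      rcases i with _ | _ | i
      · simp [workStack, k₅, k₄, n₂']
      · simp [workStack, ← e₄, l₄, k₄, k₃, bn, transferMem]
      · rw [if_neg (by omega), if_neg (by omega)]
        have hv : workStack 0 (i + 1 + 1) = 14 + 3 * i := by
          simp only [workStack, Fin.val_zero]
          omega
        rw [hv, k₅ _ (by omega) (by omega) (by omega), k₄ _ (by omega) (by omega) (by omega),
          k₃ _ (by omega) (by omega) (by omega) (by omega), bn _ (by omega)]
  obtain ⟨e, he, e8, ef⟩ := h₃.rename (workStack_injective 0) cw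
  replace e8 : e 8 = out := by
    simpa [workStack] using e8
  replace ef : ∀ j, j < 8 ∨ j = 10 → e j = c j := by
    intro j hj
    exact ef j (by intro k; simp only [workStack, Fin.val_zero]; omega)
  -- the comparisons
  have t₁ := transfer_reaches O (i := 8) (a := 3) (b := 6) (by simp) (by simp) (by simp) e
  generalize e₁ : transferMem 8 3 6 e = s₁ at t₁
  have t₂ := Exec.reaches (Exec.push (O := O) 2 true s₁)
  generalize e₂ : Function.update s₁ 2 (true :: s₁ 2) = s₂ at t₂
  have l3 : s₂ 3 = out.reverse := by simp [← e₂, ← e₁, e8, ef, cj, transferMem]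
  have l2 : s₂ 2 = true :: x.reverse := by simp [← e₂, ← e₁, ef, c2, transferMem]
  have l4 : s₂ 4 = List.replicate w.length true := by simp [← e₂, ← e₁, ef, c4, transferMem]
  have l5 : s₂ 5 = [] := by simp [← e₂, ← e₁, ef, cj, transferMem]
  have l0 : s₂ 0 = [] := by simp [← e₂, ← e₁, ef, cj, transferMem]
  have l10 : s₂ 10 = u := by simp [← e₂, ← e₁, ef, c10, transferMem]
  obtain ⟨s₃, t₃, f₃, g₃⟩ :=
    compare_reaches O (a := 4) (b := 10) (c := 5) (by simp) (by simp) (by simp) s₂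
  obtain ⟨s₄, t₄, f₄, g₄⟩ :=
    compare_reaches O (a := 3) (b := 2) (c := 5) (by simp) (by simp) (by simp) s₃
  rw [g₃ 3 (by simp) (by simp) (by simp), g₃ 2 (by simp) (by simp) (by simp), l3, l2] at f₄ t₄
  rw [l5, l4, l10] at f₃
  rw [l4, l10] at t₃
  have n0 : s₄ 0 = [] := by
    rw [g₄ 0 (by simp) (by simp) (by simp), g₃ 0 (by simp) (by simp) (by simp), l0]
  -- Both strings are compared in reversed form, so the final bit `1` could simply be pushed on top
  -- of the reversed `x`.
  have hrev : out.reverse = true :: x.reverse ↔ out = x ++ [true] := by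
    rw [← List.reverse_inj, List.reverse_reverse]
    simp
  -- The second comparison inherits the flag of the first, so an empty stack `5` now certifies both
  -- equalities.
  rw [f₃, hrev] at f₄
  obtain ⟨s₅, t₅, f₅⟩ : ∃ s₅, Reaches O (.cases 5 (.push 0 true) (.pop 0) (.pop 0)) s₄ (1 + 1) s₅ ∧
      s₅ 0 = if List.replicate w.length true = u ∧ out = x ++ [true] then [true] else [] := by
    rcases h : s₄ 5 with _ | ⟨v, k⟩
    · refine ⟨_, .cases_empty h (Exec.reaches (.push 0 true _)), ?_⟩
      rw [if_pos (by simpa using f₄.1 h)]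
      simp [n0]
    · have hne : ¬(List.replicate w.length true = u ∧ out = x ++ [true]) := by
        intro h'
        have := f₄.2 ⟨⟨rfl, h'.1⟩, h'.2⟩
        simp [h] at this
      rw [if_neg hne]
      cases v
      · exact ⟨_, .cases_false (by simp [h]) (Exec.reaches (.pop 0 _)), by simp [n0]⟩
      · exact ⟨_, .cases_true (by simp [h]) (Exec.reaches (.pop 0 _)), by simp [n0]⟩
  obtain ⟨t, ht, hE⟩ := hm _ _ _ (ha.seq (hb.seq (hc _ _ _ (he.seq
    (t₁.seq (t₂.seq (t₃.seq (t₄.seq t₅))))))))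
  refine ⟨t, ht.trans ?_, s₅, hs ▸ hE, f₅⟩
  simp only [e8, List.length_replicate, List.length_reverse, List.length_cons]
  omega

/-! ### `NP` is contained in `P^NP` -/

/-- Replace the string on stack `0` by the answer of the oracle to it. -/
def askOracle : StackProg :=
  .seq (.query 0 1) <| .seq (.loop 0 (.pop 0)) <|
    .cases 1 (.pop 0) (.push 0 false) (.push 0 true)

open Classical in
theorem askOracle_outputsWithin (O : Language Bool) (x : BitStr) :
    askOracle.OutputsWithin O [x] (2 * x.length + 4) [decide (x ∈ O)] := by
  have clear : ∀ (l : BitStr) (s : StackMem), s 0 = l →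
      Reaches O (.loop 0 (.pop 0)) s (2 * l.length + 1) (Function.update s 0 []) := by
    intro l
    induction l with
    | nil =>
      intro s hl
      rw [Function.update_eq_self_iff.2 hl.symm]
      exact Exec.reaches (.loop_done hl)
    | cons c l ih =>
      intro s hl
      have h := Reaches.loop_step (by simp [hl]) (Exec.reaches (.pop 0 s)) (ih _ (by simp [hl]))
      rw [Function.update_idem] at h
      exact h.mono (by simp only [List.length_cons]; omega)
  have t₁ := Exec.reaches (Exec.query (O := O) 0 1 (load [x]))
  generalize e₁ : Function.update (load [x]) 1 (decide (load [x] 0 ∈ O) :: load [x] 1) = s₁ at t₁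
  have t₂ := clear x s₁ (by simp [← e₁, load])
  generalize e : Function.update s₁ 0 [] = s at t₂
  have h0 : s 0 = [] := by simp [← e]
  have h1 : s 1 = [decide (x ∈ O)] := by simp [← e, ← e₁, load]
  obtain ⟨s', t₃, h'⟩ : ∃ s', Reaches O (.cases 1 (.pop 0) (.push 0 false) (.push 0 true)) s
      (1 + 1) s' ∧ s' 0 = [decide (x ∈ O)] := by
    generalize decide (x ∈ O) = v at h1
    cases v
    · exact ⟨_, .cases_false (by simp [h1]) (Exec.reaches (.push 0 false _)), by simp [h0]⟩
    · exact ⟨_, .cases_true (by simp [h1]) (Exec.reaches (.push 0 true _)), by simp [h0]⟩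
  obtain ⟨t, ht, h⟩ := t₁.seq (t₂.seq t₃)
  exact ⟨t, by omega, s', h, h'⟩

end StackProg

/-- The language serves as its own oracle, and one query decides it. -/
theorem ClassNP_subset_ClassPNP : ClassNP ⊆ ClassPNP := by
  classical
  refine fun L hL => ⟨L, hL, StackProg.askOracle, 2 * Polynomial.X + 4, fun x =>
    ⟨decide (x ∈ L), ?_, by simp⟩⟩
  simpa using StackProg.askOracle_outputsWithin L x

/-! ### Random strings as `NP` witnesses -/

theorem Polynomial.eval_nat_mono (P : Polynomial ℕ) : Monotone fun n => P.eval n := by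
  intro a b hab
  simp only [Polynomial.eval_eq_sum_range]
  gcongr

/-- The random strings from which `(x, 1)` is generated are witnesses for membership of `x`. -/
theorem ExactRandomGeneratable.language_mem_ClassNP {f : BoolFamily}
    (h : ExactRandomGeneratable f uniformInputs) : f.language ∈ ClassNP := by
  obtain ⟨desc, ℓ, A, ⟨fd, ⟨pd, Td, hd⟩, hfd⟩, ⟨fl, ⟨pl, Tl, hl⟩, hfl⟩, ⟨pA, TA, hA⟩, hgen⟩ := h
  have hd' : ∀ n, pd.OutputsWithin 0 [List.replicate n true] (Td.eval n) (desc n) := by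
    intro n
    simpa [hfd] using hd (List.replicate n true)
  have hl' : ∀ n, pl.OutputsWithin 0 [List.replicate n true] (Tl.eval n)
      (List.replicate (ℓ n) true) := by
    intro n
    simpa [hfl] using hl (List.replicate n true)
  have lenD : ∀ n, (desc n).length ≤ n + Td.eval n := fun n => by
    simpa using (hd' n).length_le
  have lenL : ∀ n, ℓ n ≤ n + Tl.eval n := fun n => by
    simpa using (hl' n).length_le
  have lenA : ∀ y z, (A y z).length ≤ y.length + TA.eval (y.length + z.length) := by
    intro y z
    obtain ⟨t, ht, s, hs, e⟩ := hA y z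
    have := hs.length_le 0
    rw [e] at this
    simp only [StackProg.load, List.getD_cons_zero] at this
    omega
  refine ⟨fun x w => if List.replicate w.length true = List.replicate (ℓ x.length) true ∧
      A (desc x.length) w = x ++ [true] then [true] else [], Polynomial.X + Tl,
    ⟨StackProg.generationVerifier pd pl pA,
      -- The verifier's cost after inserting `lenD`, `lenL`, `lenA`: `Td` is counted once for the
      -- run, ten times through `d` and ten times through `out`; `Tl` is counted `1 + 3` times and
      -- `TA` `1 + 10` times. The linear term is generous.
      21 * Td + 4 * Tl + 11 * TA.comp (2 * Polynomial.X + Td) + 60 * Polynomial.X + 20,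
      fun x w => ?_⟩, fun x => ?_⟩
  · obtain ⟨t, ht, h⟩ := StackProg.generationVerifier_outputsWithin
      (hd' x.length) (hl' x.length) (hA (desc x.length) w)
    refine ⟨t, ht.trans ?_, h⟩
    have h₁ := lenD x.length
    have h₂ := lenL x.length
    have h₃ := lenA (desc x.length) w
    have mD := Td.eval_nat_mono (Nat.le_add_right x.length w.length)
    have mL := Tl.eval_nat_mono (Nat.le_add_right x.length w.length)
    have mA := TA.eval_nat_mono (a := (desc x.length).length + w.length)
      (b := 2 * (x.length + w.length) + Td.eval (x.length + w.length)) (by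
        simp only at mD
        omega)
    simp only at mD mL mA
    simp only [Polynomial.eval_add, Polynomial.eval_mul, Polynomial.eval_comp, Polynomial.eval_X,
      Polynomial.eval_ofNat, List.length_replicate]
    omega
  · obtain ⟨X, hX, hlaw⟩ := hgen x.length
    -- Completeness needs only that the uniform law has full support.
    have surj : ∃ r, X r = x.get := by
      have : x.get ∈ ((PMF.uniformOfFintype (Fin (ℓ x.length) → Bool)).map X).support := by
        rw [hlaw]
        exact PMF.mem_support_uniformOfFintype _
      obtain ⟨r, -, hr⟩ := (PMF.mem_support_map_iff _ _ _).1 this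
      exact ⟨r, hr⟩
    constructor
    · intro hx
      obtain ⟨r, hr⟩ := surj
      refine ⟨List.ofFn r, by simpa using lenL x.length, ?_⟩
      have hx' : f x.length x.get = true := hx
      simp [hX r, hr, hx', List.ofFn_get]
    · rintro ⟨w, -, hw⟩
      have hcond : List.replicate w.length true = List.replicate (ℓ x.length) true ∧
          A (desc x.length) w = x ++ [true] := by
        by_contra hne
        exact absurd ((if_neg hne).symm.trans hw) (by simp)
      obtain ⟨hlen, hAw⟩ := hcond
      -- The length check is essential for soundness: the output of `A` is guaranteed correct only
      -- on strings of length exactly `ℓ n`.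
      replace hlen : w.length = ℓ x.length := by simpa using congrArg List.length hlen
      obtain ⟨r, rfl⟩ : ∃ r : Fin (ℓ x.length) → Bool, w = List.ofFn r := by
        rw [← hlen]
        exact ⟨w.get, (List.ofFn_get w).symm⟩
      rw [hX r] at hAw
      obtain ⟨h₁, h₂⟩ := List.append_inj' hAw rfl
      have hXr : X r = x.get := by
        apply List.ofFn_injective
        rw [h₁, List.ofFn_get]
      rw [hXr] at h₂
      exact (List.cons.inj h₂).1

/-- Every language has a characteristic family. -/
theorem exists_boolFamily (L : Language Bool) : ∃ f : BoolFamily,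
    (∀ (n : ℕ) (x : Fin n → Bool), f n x = true ↔ List.ofFn x ∈ L) ∧ f.language = L := by
  classical
  refine ⟨fun n x => decide (List.ofFn x ∈ L), by simp, ?_⟩
  ext w
  change decide (List.ofFn w.get ∈ L) = true ↔ w ∈ L
  simp

theorem mainTheorem3 :
    (∀ f : BoolFamily, IsBQPFunction f → ExactRandomGeneratable f uniformInputs →
      f.language ∈ ClassPNP) ∧
    ((∀ f : BoolFamily, IsBQPFunction f → ExactRandomGeneratable f uniformInputs) →
      ClassBQP ⊆ ClassPNP) := by
  refine ⟨fun f _ h => ClassNP_subset_ClassPNP h.language_mem_ClassNP, fun H L hL => ?_⟩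
  obtain ⟨f, hf, rfl⟩ := exists_boolFamily L
  exact ClassNP_subset_ClassPNP (H f ⟨_, hL, hf⟩).language_mem_ClassNP
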